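/- A hypergraph is \emph{linear} if any two distinct edges share at most one vertex. The \emph{wicket} $W$ is the 3-uniform hypergraph on the nine points of a $3\times 3$ matrix whose five edges are the three rows and two of the columns; $ex_L(m,W)$ is the maximum number of edges of a linear 3-uniform hypergraph on $m$ vertices with no subhypergraph isomorphic to $W$. A \emph{$(6,3)$-configuration} is a set of three edges contained in a set of six vertices. A \emph{cap set} is a set $S\subseteq\mathbb F_3^n$ without three distinct elements in arithmetic progression. For $S\subseteq\mathbb F_3^n$ let $\mathcal H_S$ be the 3-partite 3-uniform hypergraph with vertex classes $\mathbb F_3^n\times\{0\}$, $\mathbb F_3^n\times\{1\}$, $\mathbb F_3^n\times\{2\}$ (three parallel hyperplanes of $\mathbb F_3^{n+1}$) whose edges are the triples $\{a,a+s,a+2s\}$ with $a\in\mathbb F_3^n\times\{0\}$ and $s\in S\times\{1\}$. (i) For every $n\ge 0$ and every cap set $S\subseteq\mathbb F_3^n$ there is a subset $E$ of the edge set of $\mathcal H_S$ that forms a linear, 3-partite, 3-uniform hypergraph with no wicket and no $(6,3)$-configuration, with $|E|\ge 3^n|S|/(120|S|)^{1/4}$ (the right-hand side being read as $0$ when $S=\emptyset$).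 (ii) For all sufficiently large $n$ there are a cap set $S\subseteq\mathbb F_3^n$ and a subset $E$ of the edge set of $\mathcal H_S$ that forms a linear, 3-partite, 3-uniform hypergraph with no wicket and no $(6,3)$-configuration, with $|E|\ge (3^{n+1})^{1.544}$. (iii) For all sufficiently large $m$ there is a linear, 3-partite, 3-uniform hypergraph on $m$ vertices with at least $m^{1.544}$ edges that contains no wicket and no $(6,3)$-configuration; in particular, $ex_L(m,W)\ge m^{1.544}$. -/

import Mathlib

/-! A hypergraph on the vertex set `V` is given by its set of edges, a `Finset (Finset V)`. -/

namespace WicketTuran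

/-- Every edge has exactly three vertices. -/
def IsThreeUniform {V : Type*} (E : Finset (Finset V)) : Prop :=
  ∀ e ∈ E, e.card = 3

/-- Two different edges intersect in at most one vertex. -/
def IsLinear {V : Type*} [DecidableEq V] (E : Finset (Finset V)) : Prop :=
  ∀ e ∈ E, ∀ f ∈ E, e ≠ f → (e ∩ f).card ≤ 1

/-- The vertices can be split into three classes such that every edge has exactly one vertex in
each class. -/
def IsThreePartite {V : Type*} (E : Finset (Finset V)) : Prop :=
  ∃ c : V → Fin 3, ∀ e ∈ E, ∀ i : Fin 3, (e.filter (fun v => c v = i)).card = 1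

/-- `E` has a (not necessarily induced) subhypergraph isomorphic to `F`. -/
def Contains {V W : Type*} (E : Finset (Finset V)) (F : Finset (Finset W)) : Prop :=
  ∃ φ : W ↪ V, ∀ f ∈ F, f.map φ ∈ E

/-- The wicket: the three rows and two of the columns of a `3 × 3` point matrix. -/
def wicket : Finset (Finset (Fin 3 × Fin 3)) :=
  (Finset.univ.image fun i : Fin 3 => Finset.univ.image fun j : Fin 3 => (i, j)) ∪
    (({0, 1} : Finset (Fin 3)).image fun j : Fin 3 => Finset.univ.image fun i : Fin 3 => (i, j))

/-- A `(6,3)`-configuration: three edges carried by (at most) six vertices. -/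
def HasSixThree {V : Type*} [DecidableEq V] (E : Finset (Finset V)) : Prop :=
  ∃ T ⊆ E, T.card = 3 ∧ (T.biUnion id).card ≤ 6

open Classical in
/-- The linear Turán number: the maximum number of edges of a linear 3-uniform hypergraph on
`m` vertices that contains no copy of `F`. -/
noncomputable def exL {W : Type*} (m : ℕ) (F : Finset (Finset W)) : ℕ :=
  ((Finset.univ : Finset (Finset (Finset (Fin m)))).filter
    (fun E => IsThreeUniform E ∧ IsLinear E ∧ ¬ Contains E F)).sup Finset.card

/-- The Ruzsa–Szemerédi hypergraph of `S ⊆ 𝔽₃ⁿ`: its vertex set is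
`𝔽₃ⁿ⁺¹ = 𝔽₃ⁿ × 𝔽₃`, and its edges are the triples `{a, a + s', a + 2s'}` with
`a ∈ 𝔽₃ⁿ × {0}` and `s' ∈ S × {1}`. -/
def rsHypergraph (n : ℕ) (S : Finset (Fin n → ZMod 3)) :
    Finset (Finset ((Fin n → ZMod 3) × ZMod 3)) :=
  ((Finset.univ : Finset (Fin n → ZMod 3)) ×ˢ S).image fun p =>
    {(p.1, 0), (p.1, 0) + (p.2, 1), (p.1, 0) + 2 • (p.2, 1)}

end WicketTuran

/-!
Write `V = 𝔽₃ⁿ`. An edge of the Ruzsa–Szemerédi hypergraph of a cap set `S` is determined by its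
base point `a ∈ V` and its direction `s ∈ S`; its point at level `i` is `a + i s`. A set of edges
is therefore the same as a set `T` of pairs `(a, s)`, and linearity and three-partiteness are
automatic.

In a `(6,3)`-configuration three edges meet pairwise at three different levels, which forces their
directions to have sum zero; three points of a cap set with sum zero coincide, so there is none.
In a wicket the same computation applies to the directions of the three rows
(`not_contains_wicket_image_rsEdge`): the rows share one direction `u`, hence the columns share
one direction `s ≠ u`, and the base points of the three rows and of the two columns lie on one
line in direction `s - u`. Thus a wicket is a line whose three points are base points for `u` and
two of whose points are base points for `s`; sets `T` without such a line are called `GridFree`.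

For an arbitrary cap set there are at most `3 ^ n |S| ^ 2` such configurations of five pairs, and
the deletion method with density `(5 |S|) ^ (-1 / 4)` gives the first part
(`exists_gridFree_of_card`).

For the exponent `1.544`, being grid-free with directions in a cap set is preserved by products
(`IsRealizable.mul`), so one good example in a fixed dimension suffices. It lives in dimension
four: the cap set consists of the twenty nonzero zeros of a quadratic form of Witt index one, and
from each pair `±s` one vector, say `s`, is chosen. The base points for `s` are the `54` points
outside the tangent hyperplane `s^⊥`; those for `-s` are the `27` points of `s^⊥` and nine points
of a hyperplane parallel to it. If `u ≠ ±s`, a line in direction `s - u` meets all three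
hyperplanes parallel to `u^⊥`, one of which contains no base point for `u`; for opposite
directions the nine points are chosen so that no line in direction `s` contains two of them
(`gridFree_ellipticPairs`). This gives `10 * (54 + 36) = 900` pairs, and `900 > 3 ^ (4 * 1.544) ≈
884.5`. The strict inequality leaves room for every constant factor, in particular for the one
lost in passing from `3 ^ (n + 1)` to an arbitrary number of vertices.
-/

namespace WicketTuran

/-! ### Edges of the Ruzsa–Szemerédi hypergraph -/

/-- The edge of the Ruzsa–Szemerédi hypergraph with base point `p.1` and direction `p.2`. -/
def rsEdge {n : ℕ} (p : (Fin n → ZMod 3) × (Fin n → ZMod 3)) :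
    Finset ((Fin n → ZMod 3) × ZMod 3) :=
  {(p.1, 0), (p.1, 0) + (p.2, 1), (p.1, 0) + 2 • (p.2, 1)}

theorem mem_rsEdge {n : ℕ} {p : (Fin n → ZMod 3) × (Fin n → ZMod 3)}
    {v : (Fin n → ZMod 3) × ZMod 3} : v ∈ rsEdge p ↔ v.1 = p.1 + v.2 • p.2 := by
  obtain ⟨y, i⟩ := v
  have h2 : 2 • p.2 = (2 : ZMod 3) • p.2 := by rw [two_nsmul, two_smul]
  have hi : i = 0 ∨ i = 1 ∨ i = 2 := by revert i; decide
  have h12 : (1 : ZMod 3) ≠ 2 := by decide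
  have h20 : (2 : ZMod 3) ≠ 0 := by decide
  have h11 : 2 • (1 : ZMod 3) = 2 := by decide
  rcases hi with rfl | rfl | rfl <;>
    simp only [rsEdge, Finset.mem_insert, Finset.mem_singleton, Prod.ext_iff, Prod.fst_add,
      Prod.snd_add, Prod.smul_fst, Prod.smul_snd, h2, h11, zero_add, zero_smul, one_smul,
      add_zero] <;>
    simp [h12, h12.symm, h20, h20.symm]

theorem rsHypergraph_eq_image (n : ℕ) (S : Finset (Fin n → ZMod 3)) :
    rsHypergraph n S = (Finset.univ ×ˢ S).image rsEdge := rfl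

theorem rsEdge_eq_image {n : ℕ} (p : (Fin n → ZMod 3) × (Fin n → ZMod 3)) :
    rsEdge p = Finset.univ.image fun i : ZMod 3 => (p.1 + i • p.2, i) := by
  ext v
  rw [mem_rsEdge, Finset.mem_image]
  constructor
  · intro h
    exact ⟨v.2, Finset.mem_univ _, by rw [← h]⟩
  · rintro ⟨i, -, rfl⟩
    rfl

theorem card_rsEdge {n : ℕ} (p : (Fin n → ZMod 3) × (Fin n → ZMod 3)) :
    (rsEdge p).card = 3 := by
  rw [rsEdge_eq_image, Finset.card_image_of_injective]
  · rfl
  · intro i j h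
    exact congrArg Prod.snd h

/-- Two points of different levels determine the base point and the direction of an edge. -/
theorem eq_of_mem_rsEdge {n : ℕ} {p q : (Fin n → ZMod 3) × (Fin n → ZMod 3)}
    {v w : (Fin n → ZMod 3) × ZMod 3} (hvw : v ≠ w) (hvp : v ∈ rsEdge p) (hwp : w ∈ rsEdge p)
    (hvq : v ∈ rsEdge q) (hwq : w ∈ rsEdge q) : p = q := by
  rw [mem_rsEdge] at *
  have hl : v.2 - w.2 ≠ 0 := by
    intro h
    rw [sub_eq_zero] at h
    apply hvw
    rw [Prod.ext_iff]
    exact ⟨by rw [hvp, hwp, h], h⟩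
  have hs : p.2 = q.2 := by
    have : (v.2 - w.2) • p.2 = (v.2 - w.2) • q.2 := by
      rw [sub_smul, sub_smul]
      linear_combination (exp := 1) hvq - hvp - (hwq - hwp)
    exact smul_right_injective _ hl this
  have ha : p.1 = q.1 := by
    have := hvp.symm.trans hvq
    rw [hs] at this
    exact add_right_cancel this
  exact Prod.ext ha hs

theorem rsEdge_injective (n : ℕ) :
    Function.Injective (rsEdge : (Fin n → ZMod 3) × (Fin n → ZMod 3) → _) := by
  intro p q h
  have h0 : (p.1 + (0 : ZMod 3) • p.2, (0 : ZMod 3)) ∈ rsEdge p := mem_rsEdge.2 rfl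
  have h1 : (p.1 + (1 : ZMod 3) • p.2, (1 : ZMod 3)) ∈ rsEdge p := mem_rsEdge.2 rfl
  refine eq_of_mem_rsEdge ?_ h0 h1 (h ▸ h0) (h ▸ h1)
  intro h
  have h01 : (0 : ZMod 3) = 1 := congrArg Prod.snd h
  exact absurd h01 (by decide)

/-! ### Hypergraphs spanned by a set of base points and directions -/

theorem isThreeUniform_image_rsEdge {n : ℕ} (T : Finset ((Fin n → ZMod 3) × (Fin n → ZMod 3))) :
    IsThreeUniform (T.image rsEdge) := by
  intro e he
  obtain ⟨p, -, rfl⟩ := Finset.mem_image.1 he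
  exact card_rsEdge p

theorem isLinear_image_rsEdge {n : ℕ} (T : Finset ((Fin n → ZMod 3) × (Fin n → ZMod 3))) :
    IsLinear (T.image rsEdge) := by
  intro e he f hf hef
  obtain ⟨p, -, rfl⟩ := Finset.mem_image.1 he
  obtain ⟨q, -, rfl⟩ := Finset.mem_image.1 hf
  rw [Finset.card_le_one]
  intro v hv w hw
  rw [Finset.mem_inter] at hv hw
  by_contra hvw
  exact hef (congrArg rsEdge (eq_of_mem_rsEdge hvw hv.1 hw.1 hv.2 hw.2))

theorem isThreePartite_image_rsEdge {n : ℕ} (T : Finset ((Fin n → ZMod 3) × (Fin n → ZMod 3))) :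
    IsThreePartite (T.image rsEdge) := by
  have key : ∀ e ∈ T.image rsEdge, ∀ i : ZMod 3, (e.filter (fun v => v.2 = i)).card = 1 := by
    intro e he i
    obtain ⟨p, -, rfl⟩ := Finset.mem_image.1 he
    rw [Finset.card_eq_one]
    refine ⟨(p.1 + i • p.2, i), ?_⟩
    ext v
    rw [Finset.mem_filter, mem_rsEdge, Finset.mem_singleton, Prod.ext_iff]
    constructor
    · rintro ⟨h, h'⟩
      exact ⟨by rw [h, h'], h'⟩
    · rintro ⟨h, h'⟩
      exact ⟨by rw [h, h'], h'⟩
  exact ⟨Prod.snd, key⟩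

/-- Three vectors with sum zero form an arithmetic progression in characteristic three, so in a
cap set they coincide. -/
theorem eq_of_add_add_eq_zero {n : ℕ} {S : Set (Fin n → ZMod 3)} (hS : ThreeAPFree S)
    {s t u : Fin n → ZMod 3} (hs : s ∈ S) (ht : t ∈ S) (hu : u ∈ S) (h : s + t + u = 0) :
    s = t ∧ t = u := by
  have key : ∀ a b c : ZMod 3, a + b + c = 0 → a + c = b + b ∧ b + a = c + c := by decide
  have h1 : s + u = t + t := funext fun i => (key _ _ _ (congrFun h i)).1
  have h2 : t + s = u + u := funext fun i => (key _ _ _ (congrFun h i)).2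
  exact ⟨hS hs ht hu h1, hS ht hu hs h2⟩

/-- Three edges meeting pairwise at three different levels have directions with sum zero. -/
theorem dir_add_dir_add_dir_eq_zero {n : ℕ} {p q r : (Fin n → ZMod 3) × (Fin n → ZMod 3)}
    {i j k : ZMod 3} (hij : i ≠ j) (hik : i ≠ k) (hjk : j ≠ k)
    (hpq : p.1 + i • p.2 = q.1 + i • q.2) (hpr : p.1 + j • p.2 = r.1 + j • r.2)
    (hqr : q.1 + k • q.2 = r.1 + k • r.2) : p.2 + q.2 + r.2 = 0 := by
  have key : ∀ i j k : ZMod 3, i ≠ j → i ≠ k → j ≠ k →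
      i - j ≠ 0 ∧ k - i = i - j ∧ j - k = i - j := by decide
  obtain ⟨h0, h1, h2⟩ := key i j k hij hik hjk
  have : (i - j) • (p.2 + q.2 + r.2) = (i - j) • 0 := by
    have hq : (i - j) • q.2 = (k - i) • q.2 := by rw [h1]
    have hr : (i - j) • r.2 = (j - k) • r.2 := by rw [h2]
    rw [smul_add, smul_add, hq, hr]
    simp only [sub_smul, smul_zero]
    linear_combination (exp := 1) hpq - hpr + hqr
  exact smul_right_injective _ h0 this

theorem not_hasSixThree_image_rsEdge {n : ℕ} {S : Set (Fin n → ZMod 3)} (hS : ThreeAPFree S)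
    {T : Finset ((Fin n → ZMod 3) × (Fin n → ZMod 3))} (hT : ∀ p ∈ T, p.2 ∈ S) :
    ¬ HasSixThree (T.image rsEdge) := by
  rintro ⟨R, hR, hR3, hR6⟩
  obtain ⟨e, f, g, hef, heg, hfg, rfl⟩ := Finset.card_eq_three.1 hR3
  have he : e ∈ T.image rsEdge := hR (by simp)
  have hf : f ∈ T.image rsEdge := hR (by simp)
  have hg : g ∈ T.image rsEdge := hR (by simp)
  have lef := isLinear_image_rsEdge T e he f hf hef
  have leg := isLinear_image_rsEdge T e he g hg heg
  have lfg := isLinear_image_rsEdge T f hf g hg hfg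
  have ce := isThreeUniform_image_rsEdge T e he
  have cf := isThreeUniform_image_rsEdge T f hf
  have cg := isThreeUniform_image_rsEdge T g hg
  have hU : (({e, f, g} : Finset (Finset ((Fin n → ZMod 3) × ZMod 3))).biUnion id)
      = (e ∪ f) ∪ g := by
    ext v; simp
  rw [hU] at hR6
  have c1 := Finset.card_union_add_card_inter e f
  have c2 := Finset.card_union_add_card_inter (e ∪ f) g
  rw [Finset.union_inter_distrib_right] at c2
  have c3 := Finset.card_union_add_card_inter (e ∩ g) (f ∩ g)
  -- Six points leave room only for three different pairwise intersection points.
  obtain ⟨v, hv⟩ : (e ∩ f).Nonempty := Finset.card_pos.1 (by omega)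
  obtain ⟨w, hw⟩ : (e ∩ g).Nonempty := Finset.card_pos.1 (by omega)
  obtain ⟨z, hz⟩ : (f ∩ g).Nonempty := Finset.card_pos.1 (by omega)
  have hemp : (e ∩ g) ∩ (f ∩ g) = ∅ := Finset.card_eq_zero.1 (by omega)
  rw [Finset.mem_inter] at hv hw hz
  have hnot : ∀ y, y ∈ e → y ∈ f → y ∈ g → False := by
    intro y h1 h2 h3
    have : y ∈ (e ∩ g) ∩ (f ∩ g) := by simp [h1, h2, h3]
    rw [hemp] at this
    simp at this
  obtain ⟨p, hp, rfl⟩ := Finset.mem_image.1 he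
  obtain ⟨q, hq, rfl⟩ := Finset.mem_image.1 hf
  obtain ⟨r, hr, rfl⟩ := Finset.mem_image.1 hg
  have level : ∀ {x : (Fin n → ZMod 3) × (Fin n → ZMod 3)} {y y' : (Fin n → ZMod 3) × ZMod 3},
      y ∈ rsEdge x → y' ∈ rsEdge x → y.2 = y'.2 → y = y' := by
    intro x y y' h h' hl
    rw [mem_rsEdge] at h h'
    exact Prod.ext (by rw [h, h', hl]) hl
  have hvw : v.2 ≠ w.2 := fun h => hnot v hv.1 hv.2 (level hv.1 hw.1 h ▸ hw.2)
  have hvz : v.2 ≠ z.2 := fun h => hnot v hv.1 hv.2 (level hv.2 hz.1 h ▸ hz.2)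
  have hwz : w.2 ≠ z.2 := fun h => hnot w hw.1 (level hw.2 hz.2 h ▸ hz.1) hw.2
  simp only [mem_rsEdge] at hv hw hz
  have hsum := dir_add_dir_add_dir_eq_zero hvw hvz hwz (hv.1.symm.trans hv.2)
    (hw.1.symm.trans hw.2) (hz.1.symm.trans hz.2)
  have hs := (eq_of_add_add_eq_zero hS (hT p hp) (hT q hq) (hT r hr) hsum).1
  apply hef
  have h1 := hv.1.symm.trans hv.2
  rw [hs] at h1
  exact congrArg rsEdge (Prod.ext (add_right_cancel h1) hs)

/-! ### Wickets -/

/-- A set `T` of pairs (base point, direction) is grid-free if no two directions `s ≠ u` and no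
line `x, x + d, x + 2d` with `d = s - u` are such that `T` contains all three pairs with direction
`u` and the first two pairs with direction `s` over that line. Since the line has three choices of
first point, this forbids every five of the six pairs over it that include all those with
direction `u`. -/
def GridFree {V : Type*} [AddCommGroup V] (T : Finset (V × V)) : Prop :=
  ∀ x s u : V, s ≠ u → (x, u) ∈ T → (x + (s - u), u) ∈ T → (x + 2 • (s - u), u) ∈ T →
    (x, s) ∈ T → (x + (s - u), s) ∉ T

/-- In a wicket of a three-partite hypergraph, passing from the first column to the second one
shifts the classes cyclically. -/
theorem exists_shift (l m : Fin 3 → ZMod 3) (hl : Function.Injective l)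
    (hm : Function.Injective m) (hlm : ∀ i, l i ≠ m i) :
    ∃ δ : ZMod 3, (δ = 1 ∨ δ = -1) ∧ ∀ i, m i = l i + δ := by
  have key : ∀ a b c a' b' c' : ZMod 3,
      (a ≠ b ∧ a ≠ c ∧ b ≠ c) ∧ (a' ≠ b' ∧ a' ≠ c' ∧ b' ≠ c') ∧ a ≠ a' ∧ b ≠ b' ∧ c ≠ c' →
      (a' - a = 1 ∨ a' - a = -1) ∧ b' = b + (a' - a) ∧ c' = c + (a' - a) := by
    decide +kernel
  obtain ⟨hδ, h1, h2⟩ := key (l 0) (l 1) (l 2) (m 0) (m 1) (m 2)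
    ⟨⟨hl.ne (by decide), hl.ne (by decide), hl.ne (by decide)⟩,
      ⟨hm.ne (by decide), hm.ne (by decide), hm.ne (by decide)⟩, hlm 0, hlm 1, hlm 2⟩
  refine ⟨m 0 - l 0, hδ, fun i => ?_⟩
  fin_cases i
  exacts [(add_sub_cancel _ _).symm, h1, h2]

theorem not_contains_wicket_image_rsEdge {n : ℕ} {S : Set (Fin n → ZMod 3)}
    (hS : ThreeAPFree S) {T : Finset ((Fin n → ZMod 3) × (Fin n → ZMod 3))}
    (hT : ∀ p ∈ T, p.2 ∈ S) (hG : GridFree T) :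
    ¬ Contains (T.image rsEdge) wicket := by
  rintro ⟨φ, hφ⟩
  have row : ∀ i : Fin 3, ∃ p ∈ T, ∀ j, φ (i, j) ∈ rsEdge p := by
    intro i
    have := hφ (Finset.univ.image fun j : Fin 3 => (i, j)) (by simp [wicket])
    obtain ⟨p, hp, h⟩ := Finset.mem_image.1 this
    exact ⟨p, hp, fun j => by rw [h]; simp⟩
  have col : ∀ j ∈ ({0, 1} : Finset (Fin 3)), ∃ p ∈ T, ∀ i, φ (i, j) ∈ rsEdge p := by
    intro j hj
    have := hφ (Finset.univ.image fun i : Fin 3 => (i, j))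
      (Finset.mem_union_right _ (Finset.mem_image_of_mem _ hj))
    obtain ⟨p, hp, h⟩ := Finset.mem_image.1 this
    exact ⟨p, hp, fun i => by rw [h]; simp⟩
  choose r hrT hr using row
  obtain ⟨p, hpT, hp⟩ := col 0 (by simp)
  obtain ⟨q, hqT, hq⟩ := col 1 (by simp)
  have level : ∀ {y : (Fin n → ZMod 3) × (Fin n → ZMod 3)} {a b : Fin 3 × Fin 3},
      φ a ∈ rsEdge y → φ b ∈ rsEdge y → (φ a).2 = (φ b).2 → a = b := by
    intro y a b h h' hl
    rw [mem_rsEdge] at h h'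
    exact φ.injective (Prod.ext (by rw [h, h', hl]) hl)
  have hl : Function.Injective fun i => (φ (i, 0)).2 :=
    fun i j h => congrArg Prod.fst (level (hp i) (hp j) h)
  have hm : Function.Injective fun i => (φ (i, 1)).2 :=
    fun i j h => congrArg Prod.fst (level (hq i) (hq j) h)
  obtain ⟨δ, hδ, hshift⟩ := exists_shift _ _ hl hm fun i h =>
    zero_ne_one (congrArg Prod.snd (level (hr i 0) (hr i 1) h) : (0 : Fin 3) = 1)
  have hsurj : ∀ k : ZMod 3, ∃ i, (φ (i, 0)).2 = k :=
    ((Fintype.bijective_iff_injective_and_card _).2 ⟨hl, rfl⟩).2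
  -- The rows are indexed by the level of their point in the first column.
  choose ρ hρ using hsurj
  have hA : ∀ k : ZMod 3, (r (ρ k)).1 + k • (r (ρ k)).2 = p.1 + k • p.2 := by
    intro k
    have h1 := mem_rsEdge.1 (hr (ρ k) 0)
    have h2 := mem_rsEdge.1 (hp (ρ k))
    rw [hρ] at h1 h2
    exact h1.symm.trans h2
  have hB : ∀ k : ZMod 3, (r (ρ k)).1 + (k + δ) • (r (ρ k)).2 = q.1 + (k + δ) • q.2 := by
    intro k
    have h1 := mem_rsEdge.1 (hr (ρ k) 1)
    have h2 := mem_rsEdge.1 (hq (ρ k))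
    have h3 : (φ (ρ k, 1)).2 = k + δ := (hshift (ρ k)).trans (by rw [hρ])
    rw [h3] at h1 h2
    exact h1.symm.trans h2
  have hδδ : δ * δ = 1 := by rcases hδ with rfl | rfl <;> decide
  have hdir : ∀ k : ZMod 3,
      (r (ρ k)).2 = δ • (q.1 - p.1) + (1 + δ * k) • q.2 - (δ * k) • p.2 := by
    intro k
    have h : δ • (δ • (r (ρ k)).2) = δ • (q.1 + (k + δ) • q.2 - (p.1 + k • p.2)) := by
      rw [← hB k, ← hA k, add_smul]
      congr 1
      abel
    rw [smul_smul, hδδ, one_smul] at h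
    rw [h, smul_sub, smul_add, smul_add, smul_smul, smul_smul, mul_add, hδδ, smul_sub,
      add_comm (δ * k)]
    abel
  have hsum : (r (ρ 0)).2 + (r (ρ 1)).2 + (r (ρ 2)).2 = 0 := by
    rw [hdir 0, hdir 1, hdir 2]
    have key : ∀ d a b c e : ZMod 3, (d * (a - b) + (1 + d * 0) * c - (d * 0) * e) +
        (d * (a - b) + (1 + d * 1) * c - (d * 1) * e) +
        (d * (a - b) + (1 + d * 2) * c - (d * 2) * e) = 0 := by decide +kernel
    exact funext fun i => key δ (q.1 i) (p.1 i) (q.2 i) (p.2 i)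
  obtain ⟨h01, h12⟩ := eq_of_add_add_eq_zero hS (hT _ (hrT (ρ 0))) (hT _ (hrT (ρ 1)))
    (hT _ (hrT (ρ 2))) hsum
  obtain ⟨u, hu⟩ : ∃ u, u = (r (ρ 0)).2 := ⟨_, rfl⟩
  have hru : ∀ k, (r (ρ k)).2 = u := by
    intro k
    have hk : k = 0 ∨ k = 1 ∨ k = 2 := by revert k; decide
    rcases hk with rfl | rfl | rfl
    exacts [hu.symm, h01.symm.trans hu.symm, (h01.trans h12).symm.trans hu.symm]
  obtain ⟨s, hs⟩ : ∃ s, s = p.2 := ⟨_, rfl⟩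
  have hqs : q.2 = s := by
    have h := (hdir 0).symm.trans (h01.trans (hdir 1))
    have h' : δ • q.2 = δ • p.2 := by
      simp only [mul_zero, mul_one, add_smul, zero_smul] at h
      linear_combination (exp := 1) -h
    have h'' := congrArg (fun v => δ • v) h'
    simp only [smul_smul, hδδ, one_smul] at h''
    exact h''.trans hs.symm
  have hbase : ∀ k : ZMod 3, (p.1 + k • (s - u), u) ∈ T := by
    intro k
    have h := hrT (ρ k)
    have h1 : r (ρ k) = (p.1 + k • (s - u), u) := by
      refine Prod.ext ?_ (hru k)
      have := hA k
      rw [hru k, ← hs] at this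
      rw [eq_sub_of_add_eq this, smul_sub, add_sub_assoc]
    rwa [h1] at h
  have hpq : q.1 = p.1 - δ • (s - u) := by
    have h := hdir 0
    rw [hru 0, hqs, mul_zero, add_zero, zero_smul, one_smul, sub_zero] at h
    have h' : δ • (δ • (q.1 - p.1)) = δ • (u - s) := by rw [h]; simp
    rw [smul_smul, hδδ, one_smul] at h'
    rw [sub_eq_iff_eq_add.1 h', smul_sub, smul_sub]
    abel
  have hpT' : (p.1, s) ∈ T := by rw [hs]; exact hpT
  have hqT' : (p.1 - δ • (s - u), s) ∈ T := by rw [← hpq, ← hqs]; exact hqT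
  have hsu : s ≠ u := by
    intro h
    have e : r (ρ 0) = p := by
      refine Prod.ext ?_ (by rw [hru, ← h, hs])
      have := hA 0
      simpa using this
    have h1 := hr (ρ 0) 1
    rw [e] at h1
    obtain ⟨i, hi⟩ : ∃ i, (φ (i, 0)).2 = (φ (ρ 0, 1)).2 := ⟨ρ _, hρ _⟩
    exact zero_ne_one (congrArg Prod.snd (level (hp i) h1 hi) : (0 : Fin 3) = 1)
  have h2 : (2 : ZMod 3) • (s - u) = 2 • (s - u) := by rw [two_nsmul, two_smul]
  have hneg : -(s - u) = 2 • (s - u) := by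
    rw [← h2, ← neg_one_smul (ZMod 3)]
    rfl
  rcases hδ with rfl | rfl
  · rw [one_smul, sub_eq_add_neg, hneg] at hqT'
    -- The second column is based one step before the first one.
    refine hG (p.1 + 2 • (s - u)) s u hsu ?_ ?_ ?_ hqT' ?_
    · rw [← h2]
      exact hbase 2
    · have := hbase 0
      rw [zero_smul, add_zero] at this
      rwa [← hneg, neg_add_cancel_right]
    · have := hbase 1
      rw [one_smul] at this
      have e : p.1 + 2 • (s - u) + 2 • (s - u) = p.1 + (s - u) := by
        nth_rw 1 [← hneg]
        rw [two_nsmul]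
        abel
      rwa [e]
    · rwa [← hneg, neg_add_cancel_right]
  · rw [neg_one_smul, sub_neg_eq_add] at hqT'
    refine hG p.1 s u hsu ?_ ?_ ?_ hpT' hqT'
    · simpa using hbase 0
    · simpa using hbase 1
    · rw [← h2]
      exact hbase 2

/-- Every cap set `S` turns a grid-free set of pairs with directions in `S` into a hypergraph with
all the properties required of the construction, with one edge per pair. -/
theorem exists_subset_rsHypergraph {n : ℕ} {S : Finset (Fin n → ZMod 3)}
    (hS : ThreeAPFree (S : Set (Fin n → ZMod 3)))
    {T : Finset ((Fin n → ZMod 3) × (Fin n → ZMod 3))} (hT : ∀ p ∈ T, p.2 ∈ S)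
    (hG : GridFree T) :
    ∃ E ⊆ rsHypergraph n S, IsThreeUniform E ∧ IsLinear E ∧ IsThreePartite E ∧
      ¬ Contains E wicket ∧ ¬ HasSixThree E ∧ E.card = T.card := by
  refine ⟨T.image rsEdge, ?_, isThreeUniform_image_rsEdge T, isLinear_image_rsEdge T,
    isThreePartite_image_rsEdge T, not_contains_wicket_image_rsEdge hS hT hG,
    not_hasSixThree_image_rsEdge hS hT, Finset.card_image_of_injective _ (rsEdge_injective n)⟩
  rw [rsHypergraph_eq_image]
  refine Finset.image_subset_image fun p hp => ?_
  simpa using hT p hp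

/-! ### The deletion method -/

/-- A function on the cube `[0, 1]^α` that is affine in every coordinate is bounded at each point by
its value at some vertex: the method of conditional expectations. -/
theorem exists_vertex_le {α : Type*} [DecidableEq α] (s : Finset α) (f : (α → ℝ) → ℝ)
    (hf : ∀ w a, f w = (1 - w a) * f (Function.update w a 0) + w a * f (Function.update w a 1))
    (w : α → ℝ) (hw : ∀ a, 0 ≤ w a ∧ w a ≤ 1) :
    ∃ v : α → ℝ, (∀ a, 0 ≤ v a ∧ v a ≤ 1) ∧ (∀ a ∈ s, v a = 0 ∨ v a = 1) ∧ f w ≤ f v := by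
  induction s using Finset.induction_on with
  | empty => exact ⟨w, hw, by simp, le_rfl⟩
  | insert a s has ih =>
    obtain ⟨v, hv, hs, hfv⟩ := ih
    have key : ∃ ε : ℝ, (ε = 0 ∨ ε = 1) ∧ f v ≤ f (Function.update v a ε) := by
      rw [hf v a]
      have h0 := (hv a).1
      have h1 := sub_nonneg.2 (hv a).2
      rcases le_total (f (Function.update v a 0)) (f (Function.update v a 1)) with h | h
      · refine ⟨1, Or.inr rfl, ?_⟩
        have := mul_le_mul_of_nonneg_left h h1
        linarith
      · refine ⟨0, Or.inl rfl, ?_⟩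
        have := mul_le_mul_of_nonneg_left h h0
        linarith
    obtain ⟨ε, hε, hle⟩ := key
    refine ⟨Function.update v a ε, fun b => ?_, fun b hb => ?_, hfv.trans hle⟩
    · by_cases hba : b = a
      · subst hba
        rcases hε with rfl | rfl <;> simp
      · simpa [hba] using hv b
    · by_cases hba : b = a
      · subst hba
        simpa using hε
      · simpa [hba] using hs b ((Finset.mem_insert.1 hb).resolve_left hba)

/-- Deletion method: `A` has a subset containing no member of a family of `k`-sets whose size is at
least the expected size `p |A|` of a random subset of `A` of density `p` minus the expected number
`|I| p ^ k` of members of the family that it contains. -/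
theorem exists_subset_avoiding {α ι : Type*} [DecidableEq α] [Nonempty α] (A : Finset α)
    (I : Finset ι) (b : ι → Finset α) {k : ℕ} (hk : 0 < k)
    (hb : ∀ i ∈ I, (b i).card = k ∧ b i ⊆ A) {p : ℝ} (hp0 : 0 ≤ p) (hp1 : p ≤ 1) :
    ∃ T ⊆ A, (∀ i ∈ I, ¬ b i ⊆ T) ∧ p * A.card - I.card * p ^ k ≤ T.card := by
  classical
  let f : (α → ℝ) → ℝ := fun w => ∑ a ∈ A, w a - ∑ i ∈ I, ∏ a ∈ b i, w a
  have hf : ∀ w a, f w =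
      (1 - w a) * f (Function.update w a 0) + w a * f (Function.update w a 1) := by
    intro w a
    have hA : ∑ c ∈ A, w c = (1 - w a) * ∑ c ∈ A, Function.update w a 0 c +
        w a * ∑ c ∈ A, Function.update w a 1 c := by
      rw [Finset.mul_sum, Finset.mul_sum, ← Finset.sum_add_distrib]
      refine Finset.sum_congr rfl fun c _ => ?_
      by_cases hca : c = a
      · subst hca; simp
      · simp only [Function.update_of_ne hca]
        ring
    have hI : ∑ i ∈ I, ∏ c ∈ b i, w c = (1 - w a) * ∑ i ∈ I, ∏ c ∈ b i, Function.update w a 0 c +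
        w a * ∑ i ∈ I, ∏ c ∈ b i, Function.update w a 1 c := by
      rw [Finset.mul_sum, Finset.mul_sum, ← Finset.sum_add_distrib]
      refine Finset.sum_congr rfl fun i _ => ?_
      by_cases ha : a ∈ b i
      · rw [Finset.prod_update_of_mem ha, Finset.prod_update_of_mem ha,
          ← Finset.mul_prod_erase _ _ ha, Finset.sdiff_singleton_eq_erase]
        ring
      · rw [Finset.prod_update_of_notMem ha, Finset.prod_update_of_notMem ha]
        ring
    simp only [f]
    rw [hA, hI]
    ring
  obtain ⟨v, -, hv, hle⟩ := exists_vertex_le A f hf (fun _ => p) fun _ => ⟨hp0, hp1⟩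
  have hfp : f (fun _ => p) = p * A.card - I.card * p ^ k := by
    have : ∑ i ∈ I, ∏ _a ∈ b i, p = ∑ _i ∈ I, p ^ k :=
      Finset.sum_congr rfl fun i hi => by rw [Finset.prod_const, (hb i hi).1]
    simp only [f]
    rw [this, Finset.sum_const, Finset.sum_const, nsmul_eq_mul, nsmul_eq_mul, mul_comm p]
  let U := A.filter fun a => v a = 1
  let J := I.filter fun i => b i ⊆ U
  have hfv : f v = U.card - J.card := by
    have h1 : ∑ a ∈ A, v a = U.card := by
      rw [Finset.card_filter]
      push_cast
      refine Finset.sum_congr rfl fun a ha => ?_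
      rcases hv a ha with h | h <;> simp [h]
    have h2 : ∑ i ∈ I, ∏ a ∈ b i, v a = J.card := by
      rw [Finset.card_filter]
      push_cast
      refine Finset.sum_congr rfl fun i hi => ?_
      split_ifs with h
      · exact Finset.prod_eq_one fun a ha => (Finset.mem_filter.1 (h ha)).2
      · obtain ⟨a, ha, haU⟩ := Finset.not_subset.1 h
        have haA := (hb i hi).2 ha
        refine Finset.prod_eq_zero ha ((hv a haA).resolve_right fun h1 => haU ?_)
        exact Finset.mem_filter.2 ⟨haA, h1⟩
    simp only [f]
    rw [h1, h2]
  have hne : ∀ i ∈ I, ∃ a, a ∈ b i := fun i hi =>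
    Finset.card_pos.1 ((hb i hi).1 ▸ hk)
  -- One element of every member of the family inside `U` is deleted.
  choose! c hc using hne
  refine ⟨U \ J.image c, Finset.sdiff_subset.trans (Finset.filter_subset _ _), ?_, ?_⟩
  · intro i hi h
    have hiJ : i ∈ J := Finset.mem_filter.2 ⟨hi, h.trans Finset.sdiff_subset⟩
    exact (Finset.mem_sdiff.1 (h (hc i hi))).2 (Finset.mem_image_of_mem c hiJ)
  · have h1 : U.card ≤ (U \ J.image c).card + J.card := by
      have h1 := Finset.le_card_sdiff (J.image c) U
      have h2 : (J.image c).card ≤ J.card := Finset.card_image_le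
      omega
    have h2 : (U.card : ℝ) ≤ (U \ J.image c).card + J.card := by exact_mod_cast h1
    linarith

/-- Deletion in the set of all pairs with direction in `S`. -/
theorem exists_gridFree {n : ℕ} (S : Finset (Fin n → ZMod 3)) {p : ℝ} (hp0 : 0 ≤ p)
    (hp1 : p ≤ 1) :
    ∃ T : Finset ((Fin n → ZMod 3) × (Fin n → ZMod 3)), (∀ q ∈ T, q.2 ∈ S) ∧ GridFree T ∧
      p * (3 ^ n * S.card) - 3 ^ n * S.card ^ 2 * p ^ 5 ≤ T.card := by
  classical
  let b : (Fin n → ZMod 3) × (Fin n → ZMod 3) × (Fin n → ZMod 3) →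
      Finset ((Fin n → ZMod 3) × (Fin n → ZMod 3)) := fun q =>
    {(q.1, q.2.2), (q.1 + (q.2.1 - q.2.2), q.2.2), (q.1 + 2 • (q.2.1 - q.2.2), q.2.2),
      (q.1, q.2.1), (q.1 + (q.2.1 - q.2.2), q.2.1)}
  let I : Finset ((Fin n → ZMod 3) × (Fin n → ZMod 3) × (Fin n → ZMod 3)) :=
    (Finset.univ ×ˢ S ×ˢ S).filter fun q => q.2.1 ≠ q.2.2
  have hb : ∀ q ∈ I, (b q).card = 5 ∧ b q ⊆ Finset.univ ×ˢ S := by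
    rintro ⟨x, s, u⟩ hq
    simp only [I, Finset.mem_filter, Finset.mem_product, Finset.mem_univ, true_and] at hq
    obtain ⟨⟨hs, hu⟩, hsu⟩ := hq
    constructor
    · have hd : s - u ≠ 0 := sub_ne_zero.2 hsu
      have hd2 : 2 • (s - u) ≠ 0 := by
        have : 2 • (s - u) = (2 : ZMod 3) • (s - u) := by rw [two_nsmul, two_smul]
        rw [this]
        exact smul_ne_zero (by decide) hd
      have hd3 : s - u ≠ 2 • (s - u) := by
        rw [two_nsmul]
        simpa using hd
      simp only [b]
      rw [Finset.card_insert_of_notMem, Finset.card_insert_of_notMem,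
        Finset.card_insert_of_notMem, Finset.card_insert_of_notMem, Finset.card_singleton]
      all_goals
        generalize 2 • (s - u) = e at hd2 hd3 ⊢
        simp only [Finset.mem_insert, Finset.mem_singleton, Prod.mk.injEq, not_or, not_and,
          left_eq_add, add_right_inj]
        simp [hd, hd2, hd3, hsu.symm]
    · intro y hy
      simp only [b, Finset.mem_insert, Finset.mem_singleton] at hy
      rcases hy with rfl | rfl | rfl | rfl | rfl <;> simp [hs, hu]
  obtain ⟨T, hTA, hT, hcard⟩ := exists_subset_avoiding _ I b (by norm_num) hb hp0 hp1
  refine ⟨T, fun q hq => (Finset.mem_product.1 (hTA hq)).2, ?_, ?_⟩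
  · intro x s u hsu h1 h2 h3 h4 h5
    refine hT (x, s, u) ?_ ?_
    · have hs := (Finset.mem_product.1 (hTA h4)).2
      have hu := (Finset.mem_product.1 (hTA h1)).2
      simp [I, hsu, hs, hu]
    · intro y hy
      simp only [b, Finset.mem_insert, Finset.mem_singleton] at hy
      rcases hy with rfl | rfl | rfl | rfl | rfl <;> assumption
  · have hV : Fintype.card (Fin n → ZMod 3) = 3 ^ n := by simp
    have hI : I.card ≤ 3 ^ n * S.card ^ 2 := by
      refine (Finset.card_filter_le _ _).trans ?_
      rw [Finset.card_product, Finset.card_product, Finset.card_univ, hV, sq]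
    have hI' : (I.card : ℝ) ≤ 3 ^ n * S.card ^ 2 := by exact_mod_cast hI
    rw [Finset.card_product, Finset.card_univ, hV] at hcard
    push_cast at hcard
    have := mul_le_mul_of_nonneg_right hI' (pow_nonneg hp0 5)
    linarith

/-- For `p = (5 |S|) ^ (-1 / 4)` a fifth of the random subset is lost, which leaves the density
`(4 / 5) (5 |S|) ^ (-1 / 4)`; this exceeds `(120 |S|) ^ (-1 / 4)` because `(4 / 5) ^ 4 * 24 ≥ 1`. -/
theorem exists_gridFree_of_card {n : ℕ} (S : Finset (Fin n → ZMod 3)) :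
    ∃ T : Finset ((Fin n → ZMod 3) × (Fin n → ZMod 3)), (∀ q ∈ T, q.2 ∈ S) ∧ GridFree T ∧
      (3 : ℝ) ^ n * S.card / (120 * S.card) ^ ((1 : ℝ) / 4) ≤ T.card := by
  rcases S.eq_empty_or_nonempty with rfl | hS
  · exact ⟨∅, by simp, by simp [GridFree], by simp⟩
  have hc : (1 : ℝ) ≤ S.card := by exact_mod_cast Finset.card_pos.2 hS
  set c : ℝ := (S.card : ℝ) with hcdef
  set y : ℝ := (5 * c) ^ ((1 : ℝ) / 4) with hy
  set z : ℝ := (120 * c) ^ ((1 : ℝ) / 4) with hz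
  have hy0 : 0 < y := by positivity
  have hz0 : 0 < z := by positivity
  have hy4 : y ^ 4 = 5 * c := by
    rw [hy, ← Real.rpow_natCast, ← Real.rpow_mul (by positivity)]
    norm_num
  have hz4 : z ^ 4 = 120 * c := by
    rw [hz, ← Real.rpow_natCast, ← Real.rpow_mul (by positivity)]
    norm_num
  have hy1 : 1 ≤ y := by
    by_contra! h
    have := pow_lt_one₀ hy0.le h (n := 4) (by norm_num)
    linarith
  have hyz : y * 5 ≤ z * 4 := by
    refine le_of_pow_le_pow_left₀ (n := 4) (by norm_num) (by positivity) ?_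
    rw [mul_pow, mul_pow, hy4, hz4]
    linarith
  obtain ⟨T, hT, hG, hle⟩ := exists_gridFree S (p := y⁻¹) (by positivity)
    (inv_le_one_of_one_le₀ hy1)
  refine ⟨T, hT, hG, le_trans ?_ hle⟩
  rw [← hcdef]
  have h5 : c * (y⁻¹) ^ 5 = y⁻¹ / 5 := by
    have : c = y ^ 4 / 5 := by linarith
    rw [this]
    field_simp
  have h1 : y⁻¹ * (3 ^ n * c) - 3 ^ n * c ^ 2 * y⁻¹ ^ 5 = 3 ^ n * c * (4 / (y * 5)) := by
    calc _ = y⁻¹ * (3 ^ n * c) - 3 ^ n * c * (c * y⁻¹ ^ 5) := by ring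
      _ = _ := by rw [h5]; field_simp; norm_num
  rw [h1, div_eq_mul_inv]
  refine mul_le_mul_of_nonneg_left ?_ (by positivity)
  rw [inv_eq_one_div, div_le_div_iff₀ hz0 (by positivity)]
  linarith

/-! ### A dense grid-free set of dimension four -/

/-- The quadratic form `-x₀² + x₁² + x₂² + x₃²` on `𝔽₃⁴`. It has Witt index one. -/
def ellipticForm (x : Fin 4 → ZMod 3) : ZMod 3 :=
  -(x 0 * x 0) + x 1 * x 1 + x 2 * x 2 + x 3 * x 3

/-- The polar form of `ellipticForm`. -/
def ellipticPolar (x y : Fin 4 → ZMod 3) : ZMod 3 :=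
  2 * (-(x 0 * y 0) + x 1 * y 1 + x 2 * y 2 + x 3 * y 3)

/-- The twenty nonzero zeros of the elliptic quadratic form. -/
def ellipticCap : Finset (Fin 4 → ZMod 3) :=
  Finset.univ.filter fun s => s ≠ 0 ∧ ellipticForm s = 0

/-- A choice of one vector out of each pair `±s` of vectors of `ellipticCap`. -/
def IsPositive (s : Fin 4 → ZMod 3) : Prop :=
  s 0 = 1 ∨ s 0 = 0 ∧ s 1 = 1

instance : DecidablePred IsPositive := fun s => by unfold IsPositive; infer_instance

/-- The base points for the direction `s`: if `s` is the chosen vector of `±s`, all points outside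
the tangent hyperplane `s^⊥`; otherwise that hyperplane itself, and the zeros of the form in one of
the two hyperplanes parallel to it. -/
def IsBase (x s : Fin 4 → ZMod 3) : Prop :=
  if IsPositive s then ellipticPolar x s ≠ 0
  else ellipticPolar x s = 0 ∨ ellipticPolar x s = 1 ∧ ellipticForm x = 0

instance (x s : Fin 4 → ZMod 3) : Decidable (IsBase x s) := by unfold IsBase; infer_instance

/-- The grid-free set of dimension four. -/
def ellipticPairs : Finset ((Fin 4 → ZMod 3) × (Fin 4 → ZMod 3)) :=
  (Finset.univ ×ˢ ellipticCap).filter fun p => IsBase p.1 p.2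

theorem card_ellipticPairs : ellipticPairs.card = 900 := by decide +kernel

theorem ellipticPolar_eq_zero {s u : Fin 4 → ZMod 3} (hs : s ∈ ellipticCap) (hu : u ∈ ellipticCap)
    (h : ellipticPolar s u = 0) (hsu : s ≠ u) : u = -s := by
  have key : ∀ s ∈ ellipticCap, ∀ u ∈ ellipticCap, ellipticPolar s u = 0 → s ≠ u → u = -s := by
    decide +kernel
  exact key s hs u hu h hsu

theorem isPositive_neg {s : Fin 4 → ZMod 3} (hs : s ∈ ellipticCap) :
    IsPositive (-s) ↔ ¬ IsPositive s := by
  have key : ∀ s ∈ ellipticCap, IsPositive (-s) ↔ ¬ IsPositive s := by decide +kernel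
  exact key s hs

theorem threeAPFree_ellipticCap : ThreeAPFree (ellipticCap : Set (Fin 4 → ZMod 3)) := by
  have key : ∀ a ∈ ellipticCap, ∀ b ∈ ellipticCap, b + b - a ∈ ellipticCap → a = b := by
    decide +kernel
  intro a ha b hb c hc h
  refine key a ha b hb ?_
  rw [← h, add_sub_cancel_left]
  exact hc

theorem ellipticPolar_add_left (x y z : Fin 4 → ZMod 3) :
    ellipticPolar (x + y) z = ellipticPolar x z + ellipticPolar y z := by
  simp only [ellipticPolar, Pi.add_apply]
  ring

theorem ellipticPolar_sub_left (x y z : Fin 4 → ZMod 3) :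
    ellipticPolar (x - y) z = ellipticPolar x z - ellipticPolar y z := by
  simp only [ellipticPolar, Pi.sub_apply]
  ring

theorem ellipticPolar_neg_right (x y : Fin 4 → ZMod 3) :
    ellipticPolar x (-y) = -ellipticPolar x y := by
  simp only [ellipticPolar, Pi.neg_apply]
  ring

theorem ellipticPolar_self (x : Fin 4 → ZMod 3) :
    ellipticPolar x x = 2 * ellipticForm x := rfl

theorem ellipticForm_add (x y : Fin 4 → ZMod 3) :
    ellipticForm (x + y) = ellipticForm x + ellipticForm y + ellipticPolar x y := by
  simp only [ellipticPolar, ellipticForm, Pi.add_apply]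
  ring

theorem mem_ellipticPairs {p : (Fin 4 → ZMod 3) × (Fin 4 → ZMod 3)} :
    p ∈ ellipticPairs ↔ p.2 ∈ ellipticCap ∧ IsBase p.1 p.2 := by
  simp [ellipticPairs]

-- Unification must not evaluate the explicit set; membership is used through the lemma above.
attribute [irreducible] ellipticPairs

/-- The base points for a direction lie in only two of the three hyperplanes parallel to the
tangent hyperplane. -/
theorem exists_not_isBase (u : Fin 4 → ZMod 3) :
    ∃ c : ZMod 3, ∀ x, ellipticPolar x u = c → ¬ IsBase x u := by
  by_cases hu : IsPositive u
  · exact ⟨0, fun x hx => by simp [IsBase, hu, hx]⟩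
  · refine ⟨2, fun x hx => ?_⟩
    have h20 : (2 : ZMod 3) ≠ 0 := by decide
    have h21 : (2 : ZMod 3) ≠ 1 := by decide
    simp [IsBase, hu, hx, h20, h21]

/-- If `x` is a base point for both opposite directions `u` and `-u`, where `u` is the chosen one,
then `x ± u` are not base points for `-u`: the form restricted to the line through `x` in direction
`u` is affine and not constant, so `x` is its only zero there. -/
theorem not_isBase_of_isPositive {x u : Fin 4 → ZMod 3} (hu : u ∈ ellipticCap)
    (hpos : IsPositive u) (v : Fin 4 → ZMod 3) (hv : v = u ∨ v = -u) (h1 : IsBase x u)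
    (h2 : IsBase x (-u)) (h3 : IsBase (x + v) (-u)) : False := by
  have hQ : ellipticForm u = 0 := (Finset.mem_filter.1 hu).2.2
  have hneg : ¬ IsPositive (-u) := fun h => (isPositive_neg hu).1 h hpos
  have hB : ellipticPolar x u ≠ 0 := by simpa [IsBase, hpos] using h1
  have hvu : ellipticPolar v u = 0 := by
    rcases hv with rfl | rfl
    · rw [ellipticPolar_self, hQ, mul_zero]
    · have := ellipticPolar_neg_right (-u) (-u)
      rw [neg_neg, ellipticPolar_self] at this
      have hQ' : ellipticForm (-u) = 0 := by simpa [ellipticForm] using hQ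
      rw [this, hQ', mul_zero, neg_zero]
  have hB' : ellipticPolar (x + v) u ≠ 0 := by rwa [ellipticPolar_add_left, hvu, add_zero]
  have hx : ellipticForm x = 0 := by
    simp only [IsBase, if_neg hneg, ellipticPolar_neg_right, neg_eq_zero, hB, false_or] at h2
    exact h2.2
  have hxv : ellipticForm (x + v) = 0 := by
    simp only [IsBase, if_neg hneg, ellipticPolar_neg_right, neg_eq_zero, hB', false_or] at h3
    exact h3.2
  rw [ellipticForm_add, hx, zero_add] at hxv
  rcases hv with rfl | rfl
  · rw [hQ, zero_add] at hxv
    exact hB hxv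
  · have hQ' : ellipticForm (-u) = 0 := by simpa [ellipticForm] using hQ
    rw [hQ', zero_add, ellipticPolar_neg_right, neg_eq_zero] at hxv
    exact hB hxv

theorem gridFree_ellipticPairs : GridFree (V := Fin 4 → ZMod 3) ellipticPairs := by
  intro x s u hsu h1 h2 h3 h4 h5
  simp only [mem_ellipticPairs] at h1 h2 h3 h4 h5
  obtain ⟨hu, h1⟩ := h1
  obtain ⟨-, h2⟩ := h2
  obtain ⟨-, h3⟩ := h3
  obtain ⟨hs, h4⟩ := h4
  obtain ⟨-, h5⟩ := h5
  by_cases hB : ellipticPolar s u = 0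
  · -- Opposite directions: the difference of the two base points is `±` the chosen direction.
    have hus := ellipticPolar_eq_zero hs hu hB hsu
    have key : ∀ a : ZMod 3, a - -a = -a := by decide
    have hd : s - u = u := by
      rw [hus]
      exact funext fun i => key (s i)
    rw [hd] at h2 h5
    by_cases hpos : IsPositive u
    · rw [neg_eq_iff_eq_neg.1 hus.symm] at h4 h5
      exact not_isBase_of_isPositive hu hpos u (Or.inl rfl) h1 h4 h5
    · have hpos' : IsPositive s := by
        rw [← not_not (a := IsPositive s), ← isPositive_neg hs, ← hus]
        exact hpos
      rw [hus] at h1 h2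
      exact not_isBase_of_isPositive hs hpos' (-s) (Or.inr rfl) h4 h1 h2
  · -- Otherwise the line meets all three hyperplanes parallel to the tangent hyperplane of `u`.
    obtain ⟨c, hc⟩ := exists_not_isBase u
    have hQ : ellipticForm u = 0 := (Finset.mem_filter.1 hu).2.2
    have e1 : ellipticPolar (s - u) u = ellipticPolar s u := by
      rw [ellipticPolar_sub_left, ellipticPolar_self, hQ, mul_zero, sub_zero]
    have e2 : ellipticPolar (x + (s - u)) u = ellipticPolar x u + ellipticPolar s u := by
      rw [ellipticPolar_add_left, e1]
    have e3 : ellipticPolar (x + 2 • (s - u)) u =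
        ellipticPolar x u + (ellipticPolar s u + ellipticPolar s u) := by
      rw [two_nsmul, ellipticPolar_add_left, ellipticPolar_add_left, e1]
    have key : ∀ b g c : ZMod 3, g ≠ 0 → b = c ∨ b + g = c ∨ b + (g + g) = c := by decide
    rcases key (ellipticPolar x u) (ellipticPolar s u) c hB with h | h | h
    · exact hc _ h h1
    · exact hc _ (e2.trans h) h2
    · exact hc _ (e3.trans h) h3

/-! ### Products and powers -/

/-- `IsRealizable n N`: there is a grid-free set of `N` pairs in dimension `n` whose directions form
a cap set. -/
def IsRealizable (n N : ℕ) : Prop :=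
  ∃ (S : Finset (Fin n → ZMod 3)) (T : Finset ((Fin n → ZMod 3) × (Fin n → ZMod 3))),
    ThreeAPFree (S : Set (Fin n → ZMod 3)) ∧ (∀ p ∈ T, p.2 ∈ S) ∧ GridFree T ∧ T.card = N

theorem isRealizable_one (n : ℕ) : IsRealizable n 1 := by
  refine ⟨{0}, {(0, 0)}, by simp, by simp, ?_, rfl⟩
  intro x s u hsu h1 _ _ h4
  simp only [Finset.mem_singleton, Prod.mk.injEq] at h1 h4
  exact absurd (h4.2.trans h1.2.symm) hsu

/-- Realizability is multiplicative. A line over the product whose two directions differ in one of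
the factors projects there to a line of the same kind. -/
theorem IsRealizable.mul {m n M N : ℕ} (hM : IsRealizable m M) (hN : IsRealizable n N) :
    IsRealizable (m + n) (M * N) := by
  obtain ⟨S, T, hS, hT, hG, rfl⟩ := hM
  obtain ⟨S', T', hS', hT', hG', rfl⟩ := hN
  let e := Fin.appendEquiv (α := ZMod 3) m n
  let l : (Fin (m + n) → ZMod 3) → Fin m → ZMod 3 := fun a i => a (Fin.castAdd n i)
  let r : (Fin (m + n) → ZMod 3) → Fin n → ZMod 3 := fun a i => a (Fin.natAdd m i)
  have hl : ∀ y, l (e y) = y.1 := fun y => congrArg Prod.fst (e.symm_apply_apply y)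
  have hr : ∀ y, r (e y) = y.2 := fun y => congrArg Prod.snd (e.symm_apply_apply y)
  have hlr : ∀ a, e (l a, r a) = a := e.apply_symm_apply
  have hinj : ∀ {a b}, l a = l b → r a = r b → a = b := by
    intro a b h h'
    rw [← hlr a, ← hlr b, h, h']
  let g : ((Fin m → ZMod 3) × (Fin m → ZMod 3)) × ((Fin n → ZMod 3) × (Fin n → ZMod 3)) →
      (Fin (m + n) → ZMod 3) × (Fin (m + n) → ZMod 3) :=
    fun q => (e (q.1.1, q.2.1), e (q.1.2, q.2.2))
  have hg : Function.Injective g := by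
    intro q q' h
    have h1 := e.injective (congrArg Prod.fst h)
    have h2 := e.injective (congrArg Prod.snd h)
    simp only [Prod.mk.injEq] at h1 h2
    exact Prod.ext (Prod.ext h1.1 h2.1) (Prod.ext h1.2 h2.2)
  have hmem : ∀ {a s}, (a, s) ∈ (T ×ˢ T').image g → (l a, l s) ∈ T ∧ (r a, r s) ∈ T' := by
    intro a s h
    obtain ⟨q, hq, hqa⟩ := Finset.mem_image.1 h
    simp only [g, Prod.mk.injEq] at hqa
    obtain ⟨rfl, rfl⟩ := hqa
    simp only [hl, hr]
    exact Finset.mem_product.1 hq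
  refine ⟨(S ×ˢ S').image e, (T ×ˢ T').image g, ?_, ?_, ?_, ?_⟩
  · have hmemS : ∀ {a}, a ∈ (S ×ˢ S').image e → l a ∈ S ∧ r a ∈ S' := by
      intro a h
      obtain ⟨y, hy, rfl⟩ := Finset.mem_image.1 h
      rw [hl, hr]
      exact Finset.mem_product.1 hy
    intro a ha b hb c hc h
    have ha := hmemS ha
    have hb := hmemS hb
    have hc := hmemS hc
    exact hinj (hS ha.1 hb.1 hc.1 (congrArg l h)) (hS' ha.2 hb.2 hc.2 (congrArg r h))
  · rintro ⟨a, s⟩ h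
    have h := hmem h
    exact Finset.mem_image.2 ⟨(l s, r s), Finset.mem_product.2 ⟨hT _ h.1, hT' _ h.2⟩, hlr s⟩
  · intro x s u hsu h1 h2 h3 h4 h5
    have h1 := hmem h1
    have h2 := hmem h2
    have h3 := hmem h3
    have h4 := hmem h4
    have h5 := hmem h5
    by_cases h : l s = l u
    · exact hG' (r x) (r s) (r u) (fun h' => hsu (hinj h h')) h1.2 h2.2 h3.2 h4.2 h5.2
    · exact hG (l x) (l s) (l u) h h1.1 h2.1 h3.1 h4.1 h5.1
  · rw [Finset.card_image_of_injective _ hg, Finset.card_product]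

theorem isRealizable_four : IsRealizable 4 900 :=
  ⟨ellipticCap, ellipticPairs, threeAPFree_ellipticCap, fun _ hp => (mem_ellipticPairs.1 hp).1,
    gridFree_ellipticPairs, card_ellipticPairs⟩

theorem isRealizable_four_mul (k : ℕ) : IsRealizable (4 * k) (900 ^ k) := by
  induction k with
  | zero => exact isRealizable_one 0
  | succ k ih => exact ih.mul isRealizable_four

theorem isRealizable_pow (n : ℕ) : IsRealizable n (900 ^ (n / 4)) := by
  have h := (isRealizable_four_mul (n / 4)).mul (isRealizable_one (n % 4))
  rwa [Nat.div_add_mod, mul_one] at h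

/-- The exponent: `900 > 3 ^ (4 * 1.544)`. -/
theorem three_pow_rpow_lt : ((3 : ℝ) ^ 4) ^ (1.544 : ℝ) < 900 := by
  have h : (((3 : ℝ) ^ 4) ^ (1.544 : ℝ)) ^ 125 < 900 ^ 125 := by
    rw [← Real.rpow_natCast, ← Real.rpow_mul (by positivity)]
    have : (1.544 : ℝ) * ((125 : ℕ) : ℝ) = ((193 : ℕ) : ℝ) := by norm_num
    rw [this, Real.rpow_natCast]
    norm_num
  exact lt_of_pow_lt_pow_left₀ _ (by norm_num) h

/-- The base four-dimensional example beats the exponent `1.544` by a positive power, which absorbs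
every constant factor. -/
theorem eventually_mul_rpow_le (C : ℝ) (hC : 0 ≤ C) : ∃ N : ℕ, ∀ n : ℕ, N ≤ n →
    C * ((3 : ℝ) ^ (n + 1)) ^ (1.544 : ℝ) ≤ 900 ^ (n / 4) := by
  set ρ : ℝ := ((3 : ℝ) ^ 4) ^ (1.544 : ℝ) with hρ
  have hρ0 : 0 < ρ := by positivity
  have h1 : 1 < 900 / ρ := (one_lt_div hρ0).2 three_pow_rpow_lt
  obtain ⟨K, hK⟩ := pow_unbounded_of_one_lt (C * ρ) h1
  refine ⟨4 * K, fun n hn => ?_⟩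
  have hk : K ≤ n / 4 := by omega
  have h2 : C * ρ * ρ ^ (n / 4) ≤ 900 ^ (n / 4) := by
    rw [← le_div_iff₀ (by positivity), ← div_pow]
    exact hK.le.trans (pow_le_pow_right₀ h1.le hk)
  refine le_trans ?_ h2
  rw [mul_assoc]
  refine mul_le_mul_of_nonneg_left ?_ hC
  have h3 : ρ * ρ ^ (n / 4) = ((3 : ℝ) ^ (4 * (n / 4 + 1))) ^ (1.544 : ℝ) := by
    rw [← pow_succ', hρ, pow_mul, ← Real.rpow_natCast, ← Real.rpow_mul (by positivity),
      mul_comm, Real.rpow_mul (by positivity), Real.rpow_natCast]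
  rw [h3]
  refine Real.rpow_le_rpow (by positivity) ?_ (by norm_num)
  exact pow_le_pow_right₀ (by norm_num) (by omega)

/-- The construction, with an arbitrary constant factor to spare. -/
theorem exists_cap_and_edges (C : ℝ) (hC : 0 ≤ C) : ∃ N : ℕ, ∀ n : ℕ, N ≤ n →
    ∃ S : Finset (Fin n → ZMod 3), ThreeAPFree (S : Set (Fin n → ZMod 3)) ∧
      ∃ E ⊆ rsHypergraph n S, IsThreeUniform E ∧ IsLinear E ∧ IsThreePartite E ∧
        ¬ Contains E wicket ∧ ¬ HasSixThree E ∧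
        C * ((3 : ℝ) ^ (n + 1)) ^ (1.544 : ℝ) ≤ E.card := by
  obtain ⟨N, hN⟩ := eventually_mul_rpow_le C hC
  refine ⟨N, fun n hn => ?_⟩
  obtain ⟨S, T, hS, hT, hG, hcard⟩ := isRealizable_pow n
  obtain ⟨E, hE, hu, hl, hp, hw, h6, hET⟩ := exists_subset_rsHypergraph hS hT hG
  refine ⟨S, hS, E, hE, hu, hl, hp, hw, h6, (hN n hn).trans ?_⟩
  rw [hET, hcard]
  push_cast
  rfl

/-! ### Transfer to an arbitrary number of vertices -/

section Transfer

variable {V V' : Type*} (f : V ↪ V') (E : Finset (Finset V))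

/-- The image of a hypergraph under an injection of its vertex set. -/
def mapEdges : Finset (Finset V') :=
  E.map (Finset.mapEmbedding f).toEmbedding

variable {f E}

theorem mem_mapEdges {e : Finset V'} : e ∈ mapEdges f E ↔ ∃ e' ∈ E, e'.map f = e := by
  simp [mapEdges]

theorem IsThreeUniform.mapEdges (h : IsThreeUniform E) : IsThreeUniform (mapEdges f E) := by
  intro e he
  obtain ⟨d, hd, rfl⟩ := mem_mapEdges.1 he
  rw [Finset.card_map]
  exact h d hd

theorem IsLinear.mapEdges [DecidableEq V] [DecidableEq V'] (h : IsLinear E) :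
    IsLinear (mapEdges f E) := by
  intro e he e' he' hne
  obtain ⟨d, hd, rfl⟩ := mem_mapEdges.1 he
  obtain ⟨d', hd', rfl⟩ := mem_mapEdges.1 he'
  rw [← Finset.map_inter, Finset.card_map]
  exact h d hd d' hd' fun hdd => hne (by rw [hdd])

theorem IsThreePartite.mapEdges (h : IsThreePartite E) : IsThreePartite (mapEdges f E) := by
  obtain ⟨c, hc⟩ := h
  refine ⟨Function.extend f c fun _ => 0, fun e he i => ?_⟩
  obtain ⟨d, hd, rfl⟩ := mem_mapEdges.1 he
  rw [Finset.filter_map, Finset.card_map, ← hc d hd i]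
  congr 1
  refine Finset.filter_congr fun v _ => ?_
  rw [Function.comp_apply, f.injective.extend_apply]

theorem not_contains_wicket_mapEdges (h : ¬ Contains E wicket) :
    ¬ Contains (mapEdges f E) wicket := by
  rintro ⟨φ, hφ⟩
  -- Every vertex of the wicket lies in a row, hence in the image of the injection.
  have hrow : ∀ i : Fin 3, (Finset.univ.image fun j : Fin 3 => (i, j)) ∈ wicket := by
    simp [wicket]
  have hrange : ∀ a, ∃ v, f v = φ a := by
    rintro ⟨i, j⟩
    obtain ⟨e, -, he⟩ := mem_mapEdges.1 (hφ _ (hrow i))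
    have : φ (i, j) ∈ e.map f := by
      rw [he]
      simp
    obtain ⟨v, -, hv⟩ := Finset.mem_map.1 this
    exact ⟨v, hv⟩
  choose ψ hψ using hrange
  let ψ' : Fin 3 × Fin 3 ↪ V := ⟨ψ, fun a b hab => φ.injective (by rw [← hψ, ← hψ, hab])⟩
  have hψ' : ψ'.trans f = φ := by
    ext a
    exact hψ a
  refine h ⟨ψ', fun w hw => ?_⟩
  obtain ⟨e, he, hew⟩ := mem_mapEdges.1 (hφ w hw)
  rw [← hψ', ← Finset.map_map] at hew
  rwa [← Finset.map_injective f hew]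

theorem not_hasSixThree_mapEdges [DecidableEq V] [DecidableEq V'] (h : ¬ HasSixThree E) :
    ¬ HasSixThree (mapEdges f E) := by
  rintro ⟨R, hR, hR3, hR6⟩
  obtain ⟨Q, hQ, rfl⟩ := Finset.subset_map_iff.1 hR
  rw [Finset.card_map] at hR3
  refine h ⟨Q, hQ, hR3, ?_⟩
  have : (Q.map (Finset.mapEmbedding f).toEmbedding).biUnion id = (Q.biUnion id).map f := by
    ext v
    simp only [Finset.mem_biUnion, Finset.mem_map, id]
    constructor
    · rintro ⟨_, ⟨e, he, rfl⟩, hv⟩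
      obtain ⟨w, hw, rfl⟩ := Finset.mem_map.1 hv
      exact ⟨w, ⟨e, he, hw⟩, rfl⟩
    · rintro ⟨w, ⟨e, he, hw⟩, rfl⟩
      exact ⟨_, ⟨e, he, rfl⟩, Finset.mem_map_of_mem f hw⟩
  rwa [this, Finset.card_map] at hR6

theorem card_mapEdges : (mapEdges f E).card = E.card := Finset.card_map _

end Transfer

theorem card_le_exL {W : Type*} {m : ℕ} {F : Finset (Finset W)} {E : Finset (Finset (Fin m))}
    (hu : IsThreeUniform E) (hl : IsLinear E) (hF : ¬ Contains E F) : E.card ≤ exL m F := by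
  classical
  unfold exL
  refine Finset.le_sup (f := Finset.card) ?_
  rw [Finset.mem_filter]
  refine ⟨Finset.mem_univ _, hu, ?_, hF⟩
  convert hl

theorem exists_edges_fin : ∃ M : ℕ, ∀ m : ℕ, M ≤ m → ∃ E : Finset (Finset (Fin m)),
    IsThreeUniform E ∧ IsLinear E ∧ IsThreePartite E ∧ ¬ Contains E wicket ∧ ¬ HasSixThree E ∧
      (m : ℝ) ^ (1.544 : ℝ) ≤ E.card := by
  obtain ⟨N, hN⟩ := exists_cap_and_edges ((3 : ℝ) ^ (1.544 : ℝ)) (by positivity)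
  refine ⟨3 ^ (N + 1), fun m hm => ?_⟩
  have hm0 : m ≠ 0 := by
    have : 0 < 3 ^ (N + 1) := by positivity
    omega
  -- The number of vertices lies between `3 ^ (n + 1)` and `3 ^ (n + 2)`.
  obtain ⟨n, hn, hnm, hmn⟩ : ∃ n, N ≤ n ∧ 3 ^ (n + 1) ≤ m ∧ m < 3 ^ (n + 2) := by
    have h1 : N + 1 ≤ Nat.log 3 m := Nat.le_log_of_pow_le (by norm_num) hm
    refine ⟨Nat.log 3 m - 1, by omega, ?_, ?_⟩
    · rw [Nat.sub_add_cancel (by omega)]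
      exact Nat.pow_log_le_self 3 hm0
    · have := Nat.lt_pow_succ_log_self (b := 3) (by norm_num) m
      rwa [show Nat.log 3 m - 1 + 2 = (Nat.log 3 m).succ by omega]
  obtain ⟨S, -, E, -, hu, hl, hp, hw, h6, hE⟩ := hN n hn
  have hcard : Fintype.card ((Fin n → ZMod 3) × ZMod 3) ≤ Fintype.card (Fin m) := by
    simpa [← pow_succ] using hnm
  obtain ⟨f⟩ := Function.Embedding.nonempty_of_card_le hcard
  refine ⟨mapEdges f E, hu.mapEdges, hl.mapEdges, hp.mapEdges, not_contains_wicket_mapEdges hw,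
    not_hasSixThree_mapEdges h6, ?_⟩
  rw [card_mapEdges]
  refine le_trans ?_ hE
  rw [← Real.mul_rpow (by norm_num) (by positivity), ← pow_succ']
  refine Real.rpow_le_rpow (by positivity) ?_ (by norm_num)
  exact_mod_cast hmn.le

end WicketTuran

theorem mainTheorem1 :
    -- the quantitative form of the construction, for an arbitrary cap set
    (∀ (n : ℕ) (S : Finset (Fin n → ZMod 3)),
      ThreeAPFree (S : Set (Fin n → ZMod 3)) →
        ∃ E ⊆ WicketTuran.rsHypergraph n S,
          WicketTuran.IsThreeUniform E ∧ WicketTuran.IsLinear E ∧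
          WicketTuran.IsThreePartite E ∧
          ¬ WicketTuran.Contains E WicketTuran.wicket ∧ ¬ WicketTuran.HasSixThree E ∧
          (3 : ℝ) ^ n * (S.card : ℝ) / (120 * (S.card : ℝ)) ^ ((1 : ℝ) / 4) ≤ (E.card : ℝ)) ∧
    -- the exponent reached by the construction on `3 ^ (n + 1)` vertices
    (∃ N : ℕ, ∀ n : ℕ, N ≤ n → ∃ S : Finset (Fin n → ZMod 3),
      ThreeAPFree (S : Set (Fin n → ZMod 3)) ∧
        ∃ E ⊆ WicketTuran.rsHypergraph n S,
          WicketTuran.IsThreeUniform E ∧ WicketTuran.IsLinear E ∧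
          WicketTuran.IsThreePartite E ∧
          ¬ WicketTuran.Contains E WicketTuran.wicket ∧ ¬ WicketTuran.HasSixThree E ∧
          ((3 : ℝ) ^ (n + 1)) ^ (1.544 : ℝ) ≤ (E.card : ℝ)) ∧
    -- the lower bound for every sufficiently large number `m` of vertices
    (∃ M : ℕ, ∀ m : ℕ, M ≤ m →
      (∃ E : Finset (Finset (Fin m)),
        WicketTuran.IsThreeUniform E ∧ WicketTuran.IsLinear E ∧
        WicketTuran.IsThreePartite E ∧
        ¬ WicketTuran.Contains E WicketTuran.wicket ∧ ¬ WicketTuran.HasSixThree E ∧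
        (m : ℝ) ^ (1.544 : ℝ) ≤ (E.card : ℝ)) ∧
      (m : ℝ) ^ (1.544 : ℝ) ≤ (WicketTuran.exL m WicketTuran.wicket : ℝ)) := by
  refine ⟨fun n S hS => ?_, ?_, ?_⟩
  · obtain ⟨T, hT, hG, hle⟩ := WicketTuran.exists_gridFree_of_card S
    obtain ⟨E, hE, hu, hl, hp, hw, h6, hET⟩ := WicketTuran.exists_subset_rsHypergraph hS hT hG
    exact ⟨E, hE, hu, hl, hp, hw, h6, by rwa [hET]⟩
  · simpa only [one_mul] using WicketTuran.exists_cap_and_edges 1 zero_le_one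
  · obtain ⟨M, hM⟩ := WicketTuran.exists_edges_fin
    refine ⟨M, fun m hm => ?_⟩
    obtain ⟨E, hu, hl, hp, hw, h6, hE⟩ := hM m hm
    refine ⟨⟨E, hu, hl, hp, hw, h6, hE⟩, hE.trans ?_⟩
    exact_mod_cast WicketTuran.card_le_exL hu hl hw
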